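/- For an integer matrix $A\in\mathbb Z^{d\times n}$, the Graver basis $\mathcal G(A)$ is the union, over the $2^n$ orthants $\mathcal O_j$ of $\mathbb R^n$, of the nonzero elements of the inclusion-minimal Hilbert basis of the cone $\ker(A)\cap\mathcal O_j$. Given $b\in\mathbb Z^d$, $l,u\in\mathbb Z^n$, consider $$\min\{f(x): x\in F\},\qquad F=\{x\in\mathbb Z^n: Ax=b,\ l\le x\le u\},$$ where $f:\mathbb R^n\to\mathbb R$ is separable convex, i.e. $f(x)=\sum_{i=1}^n f_i(x_i)$ with convex $f_i:\mathbb R\to\mathbb R$. A greedy Graver augmentation step replaces a point $x\in F$ by a point $y=x+\alpha g\in F$ with $\alpha\in\mathbb Z_+$, $g\in\mathcal G(A)$, such that $f(y)$ is minimal among all points of $F$ of this form and $f(y)<f(x)$. **Theorem.** There is a polynomial $p$ such that for all $d,n,A,b,l,u$ and separable convex $f$ as above the following holds. Let $M$ and $\delta>0$ be rational numbers such that $|f(x)|<M$ for all $x\in F$, and such that any two distinct values of $f$ on $F$ differ by at least $\delta$ (for instance $\delta=1$ if $f$ is integer-valued on $F$). Then every feasible $x_0\in F$ is augmented to an optimal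 solution by greedy Graver augmentation steps whose number is at most $N$, the value of $p$ at the sum of the binary encoding lengths of $A,b,l,u,M,\delta$ and $x_0$. More precisely: some run of at most $N$ greedy steps from $x_0$ ends in an optimal solution; every run of greedy steps from $x_0$ has at most $N$ steps; and a run that has not reached an optimal solution can be continued by another greedy step. -/

import Mathlib

namespace GraverAug

/-- The coordinatewise embedding of `ℤⁿ` into `ℝⁿ`. -/
def toReal {n : ℕ} (z : Fin n → ℤ) : Fin n → ℝ := fun i => (z i : ℝ)

/-! ### Encoding lengths -/

/-- Binary encoding length of an integer: one sign bit plus `⌈log₂ (|z| + 1)⌉` bits. -/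
def encInt (z : ℤ) : ℕ := 1 + Nat.size z.natAbs

/-- Binary encoding length of a rational number (in lowest terms). -/
def encRat (q : ℚ) : ℕ := encInt q.num + Nat.size q.den

/-- Binary encoding length of an integer vector. -/
def encVec {n : ℕ} (v : Fin n → ℤ) : ℕ := n + ∑ i, encInt (v i)

/-- Binary encoding length of an integer matrix. -/
def encMat {d n : ℕ} (A : Matrix (Fin d) (Fin n) ℤ) : ℕ := d * n + ∑ i, ∑ j, encInt (A i j)

/-! ### The Graver basis -/

/-- The `2ⁿ` closed orthants of `ℝⁿ`, indexed by sign patterns. -/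
def orthant {n : ℕ} (s : Fin n → Bool) : Set (Fin n → ℝ) :=
  {x | ∀ j, if s j then 0 ≤ x j else x j ≤ 0}

/-- The real kernel of an integer matrix. -/
def realKer {d n : ℕ} (A : Matrix (Fin d) (Fin n) ℤ) : Set (Fin n → ℝ) :=
  {x | ∀ i, ∑ j, (A i j : ℝ) * x j = 0}

/-- `H` is a Hilbert basis of the cone `C`: a finite set of integer vectors in `C` such that every
integer vector in `C` is a nonnegative integer linear combination of elements of `H`. -/
def IsHilbertBasis {n : ℕ} (C : Set (Fin n → ℝ)) (H : Set (Fin n → ℤ)) : Prop :=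
  H.Finite ∧ (∀ h ∈ H, toReal h ∈ C) ∧
    ∀ z : Fin n → ℤ, toReal z ∈ C → z ∈ AddSubmonoid.closure H

/-- The Graver basis: the union, over all orthants, of the nonzero elements of the
inclusion-minimal Hilbert basis of the intersection of `ker A` with the orthant. -/
def graver {d n : ℕ} (A : Matrix (Fin d) (Fin n) ℤ) : Set (Fin n → ℤ) :=
  {g | g ≠ 0 ∧ ∃ (s : Fin n → Bool) (H : Set (Fin n → ℤ)),
    Minimal (IsHilbertBasis (realKer A ∩ orthant s)) H ∧ g ∈ H}

/-! ### The optimization problem -/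

/-- `f` is separable convex: `f x = ∑ i, fᵢ (xᵢ)` with convex functions `fᵢ : ℝ → ℝ`. -/
def SeparableConvex {n : ℕ} (f : (Fin n → ℝ) → ℝ) : Prop :=
  ∃ φ : Fin n → ℝ → ℝ, (∀ i, ConvexOn ℝ Set.univ (φ i)) ∧ ∀ x, f x = ∑ i, φ i (x i)

/-- The feasible set `{x ∈ ℤⁿ : A x = b, l ≤ x ≤ u}`. -/
def feasible {d n : ℕ} (A : Matrix (Fin d) (Fin n) ℤ) (b : Fin d → ℤ) (l u : Fin n → ℤ) :
    Set (Fin n → ℤ) :=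
  {x | A.mulVec x = b ∧ l ≤ x ∧ x ≤ u}

/-- `x` is an optimal solution of `min {f x : A x = b, l ≤ x ≤ u, x ∈ ℤⁿ}`. -/
def IsOptimal {d n : ℕ} (A : Matrix (Fin d) (Fin n) ℤ) (b : Fin d → ℤ) (l u : Fin n → ℤ)
    (f : (Fin n → ℝ) → ℝ) (x : Fin n → ℤ) : Prop :=
  x ∈ feasible A b l u ∧ ∀ y ∈ feasible A b l u, f (toReal x) ≤ f (toReal y)

/-- `y` arises from `x` by a greedy Graver augmentation step: `y = x + α g` with `α ∈ ℤ₊` and `g`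
in the Graver basis, `y` is feasible, `f y` is minimal among all feasible points of this form,
and the step improves the objective value. -/
def IsGreedyStep {d n : ℕ} (A : Matrix (Fin d) (Fin n) ℤ) (b : Fin d → ℤ) (l u : Fin n → ℤ)
    (f : (Fin n → ℝ) → ℝ) (x y : Fin n → ℤ) : Prop :=
  (∃ α : ℕ, ∃ g ∈ graver A, y = x + α • g) ∧ y ∈ feasible A b l u ∧
    (∀ β : ℕ, ∀ h ∈ graver A, x + β • h ∈ feasible A b l u →
      f (toReal y) ≤ f (toReal (x + β • h))) ∧
    f (toReal y) < f (toReal x)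

/-- `x 0, x 1, …, x k` is a run of `k` consecutive greedy Graver augmentation steps from `x₀`. -/
def IsGreedyRun {d n : ℕ} (A : Matrix (Fin d) (Fin n) ℤ) (b : Fin d → ℤ) (l u : Fin n → ℤ)
    (f : (Fin n → ℝ) → ℝ) (x₀ : Fin n → ℤ) (k : ℕ) (x : ℕ → Fin n → ℤ) : Prop :=
  x 0 = x₀ ∧ ∀ i < k, IsGreedyStep A b l u f (x i) (x (i + 1))

end GraverAug

namespace GraverAug

/-! ### Finite Hilbert bases -/

/-! Let `z` be optimal and `x` feasible but not optimal. The difference `z - x` lies in `ker A`, so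
it is a sum of terms `c h • h` with Graver elements `h` from one orthant. Sign compatibility has two
effects: each single move `x + c h • h` stays within the bounds, and by separable convexity the
changes of `f` along the single moves add up to at most the change from `x` to `z`
(`SeparableConvex.sum_sub_le`). With at most `K` terms, some move closes at least `1 / K` of the
gap, and a greedy step does no worse. After `K * m` steps the gap has shrunk by the factor `(1 / 2)
^ m`; since it starts below `2 * M` and is at least `δ` when nonzero, `m` linear in the encoding
lengths of `M` and `δ` suffices.

The bound on the number of terms comes from a support of minimal size: its subset sums are distinct
and lie in the box between `0` and `z - x`, so that number is at most linear in the encoding lengths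
of `l` and `u` (`exists_sparse_conformal_combination`). -/

/-- The integer points of `ker A ∩ orthant s`. -/
def latticeCone {d n : ℕ} (A : Matrix (Fin d) (Fin n) ℤ) (s : Fin n → Bool) :
    AddSubmonoid (Fin n → ℤ) where
  carrier := {z | A.mulVec z = 0 ∧ ∀ j, if s j then 0 ≤ z j else z j ≤ 0}
  zero_mem' := by simp
  add_mem' := by
    rintro a b ⟨ha, ha'⟩ ⟨hb, hb'⟩
    refine ⟨by rw [Matrix.mulVec_add, ha, hb, add_zero], fun j => ?_⟩
    have h1 := ha' j
    have h2 := hb' j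
    split_ifs with h <;> simp only [h, if_true, Pi.add_apply] at * <;> grind

lemma mem_latticeCone {d n : ℕ} {A : Matrix (Fin d) (Fin n) ℤ} {s : Fin n → Bool}
    {z : Fin n → ℤ} :
    z ∈ latticeCone A s ↔ A.mulVec z = 0 ∧ ∀ j, if s j then 0 ≤ z j else z j ≤ 0 := Iff.rfl

lemma toReal_mem_cone_iff {d n : ℕ} {A : Matrix (Fin d) (Fin n) ℤ} {s : Fin n → Bool}
    {z : Fin n → ℤ} : toReal z ∈ realKer A ∩ orthant s ↔ z ∈ latticeCone A s := by
  rw [mem_latticeCone, Set.mem_inter_iff]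
  refine and_congr ?_ ?_
  · rw [funext_iff]
    refine forall_congr' fun i => ?_
    simp only [toReal, Matrix.mulVec, dotProduct, Pi.zero_apply]
    exact_mod_cast Iff.rfl
  · refine forall_congr' fun j => ?_
    simp only [toReal]
    split_ifs <;> exact_mod_cast Iff.rfl

/-- The embedding of `ℕⁿ` onto the integer points of the orthant with sign pattern `s`. -/
def signHom {n : ℕ} (s : Fin n → Bool) : (Fin n → ℕ) →+ (Fin n → ℤ) where
  toFun v j := if s j then (v j : ℤ) else -(v j : ℤ)
  map_zero' := by ext j; simp
  map_add' v w := by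
    ext j
    simp only [Pi.add_apply]
    split_ifs <;> push_cast <;> ring

/-- Gordan's lemma: pulled back to `ℕⁿ`, the sign conditions are automatic and the kernel condition
is stable under differences, so the submonoid is subtractive, hence finitely generated. -/
lemma latticeCone_fg {d n : ℕ} (A : Matrix (Fin d) (Fin n) ℤ) (s : Fin n → Bool) :
    (latticeCone A s).FG := by
  have hfg : ((latticeCone A s).comap (signHom s)).FG := by
    refine AddSubmonoid.fg_of_subtractive fun v hv w hw => ?_
    rw [AddSubmonoid.mem_comap, mem_latticeCone] at *
    refine ⟨?_, fun j => ?_⟩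
    · have := hw.1
      rwa [map_add, Matrix.mulVec_add, hv.1, zero_add] at this
    · simp only [signHom, AddMonoidHom.coe_mk, ZeroHom.coe_mk]
      split_ifs <;> simp
  have hmap : ((latticeCone A s).comap (signHom s)).map (signHom s) = latticeCone A s := by
    refine le_antisymm (AddSubmonoid.map_le_iff_le_comap.2 le_rfl) fun z hz => ?_
    have hz' : signHom s (fun j => (z j).natAbs) = z := by
      ext j
      have := (mem_latticeCone.1 hz).2 j
      simp only [signHom, AddMonoidHom.coe_mk, ZeroHom.coe_mk]
      split_ifs at this ⊢ <;> omega
    exact ⟨_, by simpa [hz'] using hz, hz'⟩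
  rw [← hmap]
  exact hfg.map _

lemma exists_minimal_hilbertBasis {d n : ℕ} (A : Matrix (Fin d) (Fin n) ℤ)
    (s : Fin n → Bool) : ∃ H, Minimal (IsHilbertBasis (realKer A ∩ orthant s)) H := by
  obtain ⟨T, hT⟩ := latticeCone_fg A s
  have hT' : IsHilbertBasis (realKer A ∩ orthant s) (T : Set (Fin n → ℤ)) := by
    refine ⟨T.finite_toSet, fun h hh => ?_, fun z hz => ?_⟩
    · rw [toReal_mem_cone_iff, ← hT]
      exact AddSubmonoid.subset_closure hh
    · rwa [hT, ← toReal_mem_cone_iff]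
  -- Only the finitely many subsets of `T` need comparing: a Hilbert basis contained in one of them
  -- is itself a subset of `T`.
  have hfin : {H | H ⊆ (T : Set (Fin n → ℤ)) ∧
      IsHilbertBasis (realKer A ∩ orthant s) H}.Finite :=
    T.finite_toSet.finite_subsets.subset fun H hH => hH.1
  obtain ⟨H, hH⟩ := hfin.exists_minimal ⟨_, subset_rfl, hT'⟩
  exact ⟨H, hH.prop.2, fun K hK hKH => hH.le_of_le ⟨hKH.trans hH.prop.1, hK⟩ hKH⟩

/-- Every integer point of `ker A` is a nonnegative integer combination of Graver basis elements
lying in a common orthant. -/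
lemma exists_conformal_combination {d n : ℕ} (A : Matrix (Fin d) (Fin n) ℤ) (z : Fin n → ℤ)
    (hz : A.mulVec z = 0) :
    ∃ (s : Fin n → Bool) (T : Finset (Fin n → ℤ)) (c : (Fin n → ℤ) → ℕ),
      (∀ h ∈ T, h ∈ graver A ∧ h ∈ latticeCone A s) ∧ ∑ h ∈ T, c h • h = z := by
  set s : Fin n → Bool := fun j => decide (0 ≤ z j)
  obtain ⟨H, hH⟩ := exists_minimal_hilbertBasis A s
  have hzs : z ∈ latticeCone A s := by
    refine ⟨hz, fun j => ?_⟩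
    simp only [s, decide_eq_true_eq]
    split_ifs <;> omega
  have hzH : z ∈ AddSubmonoid.closure (H \ {0}) := by
    rw [AddSubmonoid.closure_sdiff_singleton_zero]
    exact hH.prop.2.2 z (toReal_mem_cone_iff.2 hzs)
  have hfin : (H \ {0}).Finite := hH.prop.1.sdiff
  rw [← hfin.coe_toFinset, AddSubmonoid.mem_closure_finset] at hzH
  obtain ⟨c, -, hc⟩ := hzH
  refine ⟨s, hfin.toFinset, c, fun h hh => ?_, hc⟩
  rw [Set.Finite.mem_toFinset] at hh
  exact ⟨⟨hh.2, s, H, hH, hh.1⟩, toReal_mem_cone_iff.1 (hH.prop.2.1 h hh.1)⟩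

/-! ### Sparse decompositions -/

/-- If two different subsets of the support of a nonnegative integer combination have the same
sum, the support can be reduced. -/
lemma exists_smaller_support {M : Type*} [AddCommGroup M] [DecidableEq M] {T S S' : Finset M}
    (c : M → ℕ) (hS : S ⊆ T) (hS' : S' ⊆ T) (hsum : ∑ h ∈ S, h = ∑ h ∈ S', h)
    (hne : ¬ S ⊆ S') :
    ∃ g ∈ T, ∃ c' : M → ℕ, ∑ h ∈ T.erase g, c' h • h = ∑ h ∈ T, c h • h := by
  have hP : (S \ S').Nonempty := Finset.sdiff_nonempty.2 hne
  obtain ⟨g, hg, hmin⟩ := Finset.exists_min_image (S \ S') c hP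
  have hgT : g ∈ T := hS (Finset.mem_sdiff.1 hg).1
  have hsd : ∑ h ∈ S \ S', h = ∑ h ∈ S' \ S, h := by
    have h1 := Finset.sum_inter_add_sum_sdiff S S' (fun h => h)
    have h2 := Finset.sum_inter_add_sum_sdiff S' S (fun h => h)
    rw [Finset.inter_comm] at h2
    rw [hsum, ← h2] at h1
    exact add_left_cancel h1
  -- Moves weight `c g` from `S \ S'` to `S' \ S`. The total is unchanged because these sets have
  -- equal sums, the subtraction never truncates because `c g` is minimal, and `g` itself gets
  -- weight `0`.
  let c' : M → ℕ := fun h => if h ∈ S \ S' then c h - c g else if h ∈ S' \ S then c h + c g else c h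
  have hkey : ∀ h ∈ T, c' h • h =
      c h • h - (if h ∈ S \ S' then c g • h else 0) + (if h ∈ S' \ S then c g • h else 0) := by
    intro h _
    by_cases h1 : h ∈ S \ S'
    · have h2 : h ∉ S' \ S := fun h2 => (Finset.mem_sdiff.1 h2).2 (Finset.mem_sdiff.1 h1).1
      simp only [c', h1, h2, if_true, if_false, add_zero]
      rw [eq_sub_iff_add_eq, ← add_smul, Nat.sub_add_cancel (hmin h h1)]
    · by_cases h2 : h ∈ S' \ S
      · simp only [c', h1, h2, if_true, if_false, sub_zero, add_smul]
      · simp only [c', h1, h2, if_false, sub_zero, add_zero]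
  refine ⟨g, hgT, c', ?_⟩
  have hg0 : c' g • g = 0 := by simp only [c', hg, if_true, Nat.sub_self, zero_smul]
  rw [Finset.sum_erase (f := fun h => c' h • h) _ hg0, Finset.sum_congr rfl hkey, Finset.sum_add_distrib,
    Finset.sum_sub_distrib, Finset.sum_ite_mem, Finset.sum_ite_mem,
    Finset.inter_eq_right.2 (Finset.sdiff_subset.trans hS),
    Finset.inter_eq_right.2 (Finset.sdiff_subset.trans hS'), ← Finset.smul_sum,
    ← Finset.smul_sum, hsd, sub_add_cancel]

/-- Confines subset sums to the box spanned by the full combination, coordinate by coordinate. -/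
lemma sum_mem_uIcc {ι : Type*} {S T : Finset ι} (hST : S ⊆ T) {a : ι → ℤ} {c : ι → ℕ}
    (ha : (∀ h ∈ T, 0 ≤ a h) ∨ (∀ h ∈ T, a h ≤ 0)) (hc : ∀ h ∈ T, 1 ≤ c h) :
    ∑ h ∈ S, a h ∈ Finset.uIcc 0 (∑ h ∈ T, c h • a h) := by
  simp only [nsmul_eq_mul]
  rcases ha with ha | ha
  · have h0 : 0 ≤ ∑ h ∈ S, a h := Finset.sum_nonneg fun h hh => ha h (hST hh)
    have h1 : ∑ h ∈ S, a h ≤ ∑ h ∈ T, a h :=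
      Finset.sum_le_sum_of_subset_of_nonneg hST fun h hh _ => ha h hh
    have h2 : ∑ h ∈ T, a h ≤ ∑ h ∈ T, (c h : ℤ) * a h := Finset.sum_le_sum fun h hh => by
      have := ha h hh
      have : (1 : ℤ) ≤ c h := by exact_mod_cast hc h hh
      nlinarith
    rw [Finset.uIcc_of_le (by linarith), Finset.mem_Icc]
    constructor <;> linarith
  · have h0 : ∑ h ∈ S, a h ≤ 0 := Finset.sum_nonpos fun h hh => ha h (hST hh)
    have h1 : ∑ h ∈ T, a h ≤ ∑ h ∈ S, a h := by
      have := Finset.sum_le_sum_of_subset_of_nonneg (f := fun h => - a h) hST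
        fun h hh _ => by simpa using ha h hh
      simpa using this
    have h2 : ∑ h ∈ T, (c h : ℤ) * a h ≤ ∑ h ∈ T, a h := Finset.sum_le_sum fun h hh => by
      have := ha h hh
      have : (1 : ℤ) ≤ c h := by exact_mod_cast hc h hh
      nlinarith
    rw [Finset.uIcc_of_ge (by linarith), Finset.mem_Icc]
    constructor <;> linarith

lemma latticeCone_sign {d n : ℕ} {A : Matrix (Fin d) (Fin n) ℤ} {s : Fin n → Bool}
    {T : Finset (Fin n → ℤ)} (hT : ∀ h ∈ T, h ∈ latticeCone A s) (j : Fin n) :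
    (∀ h ∈ T, 0 ≤ h j) ∨ (∀ h ∈ T, h j ≤ 0) := by
  cases hs : s j
  · right
    intro h hh
    simpa [hs] using (hT h hh).2 j
  · left
    intro h hh
    simpa [hs] using (hT h hh).2 j

/-- A conformal decomposition into Graver basis elements with few terms (an integer Carathéodory
theorem, proved by counting subset sums). -/
lemma exists_sparse_conformal_combination {d n : ℕ} (A : Matrix (Fin d) (Fin n) ℤ)
    (z : Fin n → ℤ) (hz : A.mulVec z = 0) :
    ∃ (s : Fin n → Bool) (T : Finset (Fin n → ℤ)) (c : (Fin n → ℤ) → ℕ),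
      (∀ h ∈ T, h ∈ graver A ∧ h ∈ latticeCone A s) ∧ ∑ h ∈ T, c h • h = z ∧
      2 ^ T.card ≤ ∏ j, ((z j).natAbs + 1) := by
  classical
  obtain ⟨s, T₀, c₀, hT₀, hc₀⟩ := exists_conformal_combination A z hz
  have hex : ∃ k, ∃ (T : Finset (Fin n → ℤ)) (c : (Fin n → ℤ) → ℕ),
      (∀ h ∈ T, h ∈ graver A ∧ h ∈ latticeCone A s) ∧ ∑ h ∈ T, c h • h = z ∧ T.card = k :=
    ⟨_, T₀, c₀, hT₀, hc₀, rfl⟩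
  obtain ⟨T, c, hT, hc, hcard⟩ := Nat.find_spec hex
  have herase : ∀ g ∈ T, ∀ c' : (Fin n → ℤ) → ℕ, ∑ h ∈ T.erase g, c' h • h ≠ z := by
    intro g hg c' hc'
    refine Nat.find_min hex (m := (T.erase g).card) ?_
      ⟨T.erase g, c', fun h hh => hT h (Finset.mem_of_mem_erase hh), hc', rfl⟩
    rw [← hcard]
    exact Finset.card_erase_lt_of_mem hg
  have hpos : ∀ h ∈ T, 1 ≤ c h := by
    intro h hh
    by_contra h0
    refine herase h hh c ?_
    rw [Finset.sum_erase, hc]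
    simp [show c h = 0 by omega]
  refine ⟨s, T, c, hT, hc, ?_⟩
  by_contra! hlt
  have hbox : (Finset.uIcc 0 z).card = ∏ j, ((z j).natAbs + 1) := by
    simp [Pi.card_uIcc, Int.card_uIcc]
  rw [← hbox, ← Finset.card_powerset] at hlt
  have hmaps : ∀ S ∈ T.powerset, ∑ h ∈ S, h ∈ Finset.uIcc 0 z := by
    intro S hS
    have key : ∀ j, (∑ h ∈ S, h) j ∈ Finset.uIcc 0 (z j) := by
      intro j
      have := sum_mem_uIcc (Finset.mem_powerset.1 hS) (a := fun h : Fin n → ℤ => h j)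
        (latticeCone_sign (fun h hh => (hT h hh).2) j) hpos
      rw [← hc]
      simpa [Finset.sum_apply] using this
    simp only [Finset.uIcc, Finset.mem_Icc] at key ⊢
    exact ⟨fun j => (key j).1, fun j => (key j).2⟩
  -- Pigeonhole: more subsets than box points give two subsets with equal sums, so a term could be
  -- removed, against minimality.
  obtain ⟨S, hS, S', hS', hne, hsum⟩ :=
    Finset.exists_ne_map_eq_of_card_lt_of_maps_to hlt hmaps
  rw [Finset.mem_powerset] at hS hS'
  by_cases hsub : S ⊆ S'
  · obtain ⟨g, hg, c', hc'⟩ := exists_smaller_support c hS' hS hsum.symm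
      fun h => hne (hsub.antisymm h)
    exact herase g hg c' (hc'.trans hc)
  · obtain ⟨g, hg, c', hc'⟩ := exists_smaller_support c hS hS' hsum hsub
    exact herase g hg c' (hc'.trans hc)

/-! ### Superadditivity -/

/-- As `a` and `b` do not have opposite signs, `x + a` and `x + b` are convex combinations of `x`
and `x + (a + b)` with swapped weights; the two convexity inequalities are added. -/
lemma convex_add_le {φ : ℝ → ℝ} (hφ : ConvexOn ℝ Set.univ φ) (x : ℝ) {a b : ℝ}
    (hab : 0 ≤ a * b) : φ (x + a) + φ (x + b) ≤ φ (x + (a + b)) + φ x := by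
  by_cases h0 : a + b = 0
  · have ha : a = 0 := by nlinarith
    have hb : b = 0 := by linarith
    simp [ha, hb]
  have hw : ∀ p q : ℝ, 0 ≤ p * q → 0 ≤ p / (p + q) := by
    intro p q hpq
    have : p / (p + q) = (p * p + p * q) / (p + q) ^ 2 := by
      rcases eq_or_ne (p + q) 0 with h | h
      · simp [h]
      · field_simp
    rw [this]
    exact div_nonneg (add_nonneg (mul_self_nonneg p) hpq) (sq_nonneg _)
  have hsum : a / (a + b) + b / (a + b) = 1 := by rw [← add_div, div_self h0]
  have hbw : 0 ≤ b / (a + b) := by rw [add_comm]; exact hw b a (by linarith)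
  have h1 := hφ.2 (Set.mem_univ (x + (a + b))) (Set.mem_univ x) (hw a b hab) hbw hsum
  have h2 := hφ.2 (Set.mem_univ x) (Set.mem_univ (x + (a + b))) (hw a b hab) hbw hsum
  simp only [smul_eq_mul] at h1 h2
  have e1 : a / (a + b) * (x + (a + b)) + b / (a + b) * x = x + a := by field_simp; ring
  have e2 : a / (a + b) * x + b / (a + b) * (x + (a + b)) = x + b := by field_simp; ring
  rw [e1] at h1
  rw [e2] at h2
  have e3 : b / (a + b) = 1 - a / (a + b) := by linarith
  rw [e3] at h1 h2
  linarith

lemma convex_sum_sub_le {ι : Type*} {φ : ℝ → ℝ} (hφ : ConvexOn ℝ Set.univ φ) (x : ℝ)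
    (T : Finset ι) (a : ι → ℝ) (ha : (∀ h ∈ T, 0 ≤ a h) ∨ (∀ h ∈ T, a h ≤ 0)) :
    ∑ h ∈ T, (φ (x + a h) - φ x) ≤ φ (x + ∑ h ∈ T, a h) - φ x := by
  classical
  induction T using Finset.induction_on with
  | empty => simp
  | insert g T hg ih =>
    have ih' := ih (ha.imp (fun h i hi => h i (Finset.mem_insert_of_mem hi))
      (fun h i hi => h i (Finset.mem_insert_of_mem hi)))
    rw [Finset.sum_insert hg, Finset.sum_insert hg]
    have hprod : 0 ≤ a g * ∑ h ∈ T, a h := by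
      rcases ha with ha | ha
      · exact mul_nonneg (ha g (Finset.mem_insert_self _ _))
          (Finset.sum_nonneg fun i hi => ha i (Finset.mem_insert_of_mem hi))
      · exact mul_nonneg_of_nonpos_of_nonpos (ha g (Finset.mem_insert_self _ _))
          (Finset.sum_nonpos fun i hi => ha i (Finset.mem_insert_of_mem hi))
    have := convex_add_le hφ x hprod
    linarith

lemma SeparableConvex.sum_sub_le {d n : ℕ} {A : Matrix (Fin d) (Fin n) ℤ}
    {f : (Fin n → ℝ) → ℝ} (hf : SeparableConvex f) {s : Fin n → Bool}
    {T : Finset (Fin n → ℤ)} (hT : ∀ h ∈ T, h ∈ latticeCone A s) (c : (Fin n → ℤ) → ℕ)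
    (x : Fin n → ℤ) :
    ∑ h ∈ T, (f (toReal (x + c h • h)) - f (toReal x)) ≤
      f (toReal (x + ∑ h ∈ T, c h • h)) - f (toReal x) := by
  obtain ⟨φ, hφ, hfφ⟩ := hf
  simp only [hfφ, ← Finset.sum_sub_distrib]
  rw [Finset.sum_comm]
  refine Finset.sum_le_sum fun j _ => ?_
  have := convex_sum_sub_le (hφ j) (x j) T (fun h => (c h : ℝ) * (h j : ℝ)) (by
    refine (latticeCone_sign hT j).imp (fun H h hh => ?_) (fun H h hh => ?_)
    · exact mul_nonneg (Nat.cast_nonneg _) (by exact_mod_cast H h hh)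
    · exact mul_nonpos_of_nonneg_of_nonpos (Nat.cast_nonneg _) (by exact_mod_cast H h hh))
  simpa [toReal, Finset.sum_apply] using this

/-! ### Encoding lengths -/

lemma natAbs_sub_add_one_le (a b : ℤ) :
    (a - b).natAbs + 1 ≤ 2 ^ (a.natAbs.size + b.natAbs.size) := by
  have ha := Nat.lt_size_self a.natAbs
  have hb := Nat.lt_size_self b.natAbs
  have h1 : (a - b).natAbs ≤ a.natAbs + b.natAbs := Int.natAbs_sub_le a b
  rw [pow_add]
  generalize 2 ^ a.natAbs.size = p at *
  generalize 2 ^ b.natAbs.size = q at *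
  have h2 : (a.natAbs + 1) * (b.natAbs + 1) ≤ p * q := Nat.mul_le_mul ha hb
  have h3 : 0 ≤ a.natAbs * b.natAbs := Nat.zero_le _
  linarith

lemma sum_size_le_encVec {n : ℕ} (v : Fin n → ℤ) : ∑ j, (v j).natAbs.size ≤ encVec v :=
  (Finset.sum_le_sum fun _ _ => Nat.le_add_left _ 1).trans (Nat.le_add_left _ n)

lemma le_two_pow_encRat (q : ℚ) : (q : ℝ) ≤ 2 ^ encRat q := by
  have h1 : (q.num : ℝ) ≤ 2 ^ q.num.natAbs.size := by
    have h := (Nat.lt_size_self q.num.natAbs).le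
    have h' : q.num ≤ (q.num.natAbs : ℤ) := Int.le_natAbs
    calc (q.num : ℝ) ≤ ((q.num.natAbs : ℤ) : ℝ) := by exact_mod_cast h'
      _ ≤ _ := by exact_mod_cast h
  have hden : (1 : ℝ) ≤ q.den := by exact_mod_cast q.den_pos
  rw [Rat.cast_def, div_le_iff₀ (by linarith)]
  have h2 : (2 : ℝ) ^ q.num.natAbs.size ≤ 2 ^ encRat q :=
    pow_le_pow_right₀ (by norm_num) (by unfold encRat encInt; omega)
  exact (h1.trans h2).trans (le_mul_of_one_le_right (by positivity) hden)

lemma inv_two_pow_encRat_le {q : ℚ} (hq : 0 < q) : 1 ≤ (q : ℝ) * 2 ^ encRat q := by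
  have h1 : (1 : ℝ) ≤ q.num := by exact_mod_cast Rat.num_pos.2 hq
  have hden : (0 : ℝ) < q.den := by exact_mod_cast q.den_pos
  have h2 : (q.den : ℝ) ≤ 2 ^ encRat q := by
    have h := (Nat.lt_size_self q.den).le
    calc (q.den : ℝ) ≤ 2 ^ q.den.size := by exact_mod_cast h
      _ ≤ _ := pow_le_pow_right₀ (by norm_num) (by unfold encRat; omega)
  rw [Rat.cast_def, div_mul_eq_mul_div, le_div_iff₀ hden]
  nlinarith

/-! ### Augmentation steps -/

variable {d n : ℕ} {A : Matrix (Fin d) (Fin n) ℤ} {b : Fin d → ℤ} {l u : Fin n → ℤ}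
  {f : (Fin n → ℝ) → ℝ}

lemma feasible_finite (A : Matrix (Fin d) (Fin n) ℤ) (b : Fin d → ℤ) (l u : Fin n → ℤ) :
    (feasible A b l u).Finite :=
  (Set.finite_Icc l u).subset fun _ hx => ⟨hx.2.1, hx.2.2⟩

/-- Moving from a feasible point towards another one along a term of a conformal decomposition
keeps feasibility. -/
lemma add_smul_mem_feasible {s : Fin n → Bool} {T : Finset (Fin n → ℤ)}
    (hT : ∀ h ∈ T, h ∈ latticeCone A s) (c : (Fin n → ℤ) → ℕ) {x : Fin n → ℤ}
    (hx : x ∈ feasible A b l u) (hy : x + ∑ h ∈ T, c h • h ∈ feasible A b l u)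
    {g : Fin n → ℤ} (hg : g ∈ T) : x + c g • g ∈ feasible A b l u := by
  have hker : A.mulVec (c g • g) = 0 := ((latticeCone A s).nsmul_mem (hT g hg) (c g)).1
  have hcoord : ∀ j, l j ≤ x j + c g * g j ∧ x j + c g * g j ≤ u j := by
    intro j
    have hl := hx.2.1 j
    have hu := hx.2.2 j
    have hl' := hy.2.1 j
    have hu' := hy.2.2 j
    simp only [Pi.add_apply, Finset.sum_apply, Pi.smul_apply] at hl' hu'
    simp only [nsmul_eq_mul] at hl' hu'
    rcases latticeCone_sign hT j with H | H
    · have h1 : (0 : ℤ) ≤ c g * g j := mul_nonneg (Nat.cast_nonneg _) (H g hg)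
      have h2 : (c g : ℤ) * g j ≤ ∑ h ∈ T, (c h : ℤ) * h j :=
        Finset.single_le_sum (f := fun h : Fin n → ℤ => (c h : ℤ) * h j)
          (fun h hh => mul_nonneg (Nat.cast_nonneg _) (H h hh)) hg
      constructor <;> linarith
    · have h1 : (c g : ℤ) * g j ≤ 0 :=
        mul_nonpos_of_nonneg_of_nonpos (Nat.cast_nonneg _) (H g hg)
      have h2 := Finset.single_le_sum (f := fun h : Fin n → ℤ => -((c h : ℤ) * h j))
          (fun h hh => neg_nonneg.2
            (mul_nonpos_of_nonneg_of_nonpos (Nat.cast_nonneg _) (H h hh))) hg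
      simp only [Finset.sum_neg_distrib] at h2
      constructor <;> linarith
  refine ⟨by rw [Matrix.mulVec_add, hker, add_zero, hx.1], fun j => ?_, fun j => ?_⟩
  · simpa using (hcoord j).1
  · simpa using (hcoord j).2

/-- Some multiple of a Graver basis element closes a fraction `1 / K` of the gap to `y`. -/
lemma exists_good_augmentation (hf : SeparableConvex f) {x y : Fin n → ℤ}
    (hx : x ∈ feasible A b l u) (hy : y ∈ feasible A b l u)
    (hlt : f (toReal y) < f (toReal x)) {K : ℕ} (hK : encVec l + encVec u ≤ K) :
    ∃ α : ℕ, ∃ g ∈ graver A, x + α • g ∈ feasible A b l u ∧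
      f (toReal x) - f (toReal y) ≤ K * (f (toReal x) - f (toReal (x + α • g))) := by
  have hz : A.mulVec (y - x) = 0 := by rw [Matrix.mulVec_sub, hx.1, hy.1, sub_self]
  obtain ⟨s, T, c, hT, hc, hcard⟩ := exists_sparse_conformal_combination A (y - x) hz
  have hT' : ∀ h ∈ T, h ∈ latticeCone A s := fun h hh => (hT h hh).2
  have hxy : x + ∑ h ∈ T, c h • h = y := by rw [hc]; abel
  have hTK : T.card ≤ K := by
    refine le_trans ?_ hK
    -- Both points lie in `[l, u]`, so each coordinate of `y - x` is at most `u j - l j` in absolute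
    -- value.
    have h1 : ∏ j, (((y - x) j).natAbs + 1) ≤
        ∏ j, 2 ^ ((u j).natAbs.size + (l j).natAbs.size) := by
      refine Finset.prod_le_prod' fun j _ => ?_
      refine le_trans ?_ (natAbs_sub_add_one_le (u j) (l j))
      have hlx : l j ≤ x j := hx.2.1 j
      have hxu : x j ≤ u j := hx.2.2 j
      have hly : l j ≤ y j := hy.2.1 j
      have hyu : y j ≤ u j := hy.2.2 j
      simp only [Pi.sub_apply]
      omega
    rw [Finset.prod_pow_eq_pow_sum, Finset.sum_add_distrib] at h1
    have h2 := (Nat.pow_le_pow_iff_right (by norm_num)).1 (hcard.trans h1)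
    have := sum_size_le_encVec l
    have := sum_size_le_encVec u
    omega
  have hsup := hf.sum_sub_le hT' c x
  rw [hxy] at hsup
  have hne : T.Nonempty := by
    rw [Finset.nonempty_iff_ne_empty]
    rintro rfl
    simp only [Finset.sum_empty] at hsup
    linarith
  obtain ⟨g, hg, hmin⟩ :=
    Finset.exists_min_image T (fun h => f (toReal (x + c h • h)) - f (toReal x)) hne
  refine ⟨c g, g, (hT g hg).1, add_smul_mem_feasible hT' c hx (by rwa [hxy]) hg, ?_⟩
  have h1 := Finset.card_nsmul_le_sum T _ _ hmin
  rw [nsmul_eq_mul] at h1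
  have h2 : (T.card : ℝ) ≤ K := by exact_mod_cast hTK
  have h3 : (0 : ℝ) < T.card := by exact_mod_cast hne.card_pos
  have h4 : f (toReal x) - f (toReal y) ≤
      T.card * (f (toReal x) - f (toReal (x + c g • g))) := by linarith
  -- Nonnegativity of the gain allows `T.card` to be replaced by the larger `K`.
  have h5 : 0 ≤ f (toReal x) - f (toReal (x + c g • g)) := by
    by_contra! h5
    nlinarith
  nlinarith

/-- A greedy step exists at every feasible point that is not optimal. -/
lemma exists_greedyStep (hf : SeparableConvex f) {x : Fin n → ℤ}
    (hx : x ∈ feasible A b l u) (hopt : ¬ IsOptimal A b l u f x) :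
    ∃ y, IsGreedyStep A b l u f x y := by
  obtain ⟨y, hy, hlt⟩ : ∃ y ∈ feasible A b l u, f (toReal y) < f (toReal x) := by
    by_contra! h
    exact hopt ⟨hx, h⟩
  obtain ⟨α, g, hg, hfeas, hgap⟩ := exists_good_augmentation hf hx hy hlt le_rfl
  have hfin : {w | (∃ α : ℕ, ∃ g ∈ graver A, w = x + α • g) ∧ w ∈ feasible A b l u}.Finite :=
    (feasible_finite A b l u).subset fun w hw => hw.2
  obtain ⟨w, ⟨hw, hwf⟩, hmin⟩ :=
    Set.exists_min_image _ (fun w => f (toReal w)) hfin ⟨_, ⟨α, g, hg, rfl⟩, hfeas⟩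
  have h1 := hmin _ ⟨⟨α, g, hg, rfl⟩, hfeas⟩
  have h2 : f (toReal (x + α • g)) < f (toReal x) := by
    by_contra! h
    have : (0 : ℝ) ≤ ((encVec l + encVec u : ℕ) : ℝ) := Nat.cast_nonneg _
    nlinarith
  exact ⟨w, hw, hwf, fun β h hh hβ => hmin _ ⟨⟨β, h, hh, rfl⟩, hβ⟩, h1.trans_lt h2⟩

/-- A greedy step shrinks the gap to the optimum by the factor `1 - 1 / K`. -/
lemma IsGreedyStep.gap_le (hf : SeparableConvex f) {x y z : Fin n → ℤ}
    (hx : x ∈ feasible A b l u) (hz : IsOptimal A b l u f z) (hxy : IsGreedyStep A b l u f x y)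
    {K : ℕ} (hK : encVec l + encVec u ≤ K) (hK0 : 0 < K) :
    f (toReal y) - f (toReal z) ≤ (1 - 1 / K) * (f (toReal x) - f (toReal z)) := by
  obtain ⟨-, hy, hmin, hlt⟩ := hxy
  obtain ⟨α, g, hg, hfeas, hgap⟩ :=
    exists_good_augmentation hf hx hz.1 ((hz.2 y hy).trans_lt hlt) hK
  have h1 := hmin α g hg hfeas
  have hK' : (0 : ℝ) < K := by exact_mod_cast hK0
  have h2 : (f (toReal x) - f (toReal z)) / K ≤ f (toReal x) - f (toReal y) := by
    rw [div_le_iff₀' hK']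
    exact hgap.trans (mul_le_mul_of_nonneg_left (by linarith) hK'.le)
  have h3 : (1 - 1 / (K : ℝ)) * (f (toReal x) - f (toReal z)) =
      f (toReal x) - f (toReal z) - (f (toReal x) - f (toReal z)) / K := by ring
  linarith

lemma IsGreedyRun.mem_feasible {x₀ : Fin n → ℤ} (hx₀ : x₀ ∈ feasible A b l u) {k : ℕ}
    {x : ℕ → Fin n → ℤ} (hx : IsGreedyRun A b l u f x₀ k x) {i : ℕ} (hi : i ≤ k) :
    x i ∈ feasible A b l u := by
  rcases i with _ | i
  · rwa [hx.1]
  · exact (hx.2 i hi).2.1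

lemma IsGreedyRun.gap_le (hf : SeparableConvex f) {x₀ z : Fin n → ℤ}
    (hx₀ : x₀ ∈ feasible A b l u) (hz : IsOptimal A b l u f z) {k : ℕ} {x : ℕ → Fin n → ℤ}
    (hx : IsGreedyRun A b l u f x₀ k x) {K : ℕ} (hK : encVec l + encVec u ≤ K) (hK0 : 0 < K)
    {i : ℕ} (hi : i ≤ k) :
    f (toReal (x i)) - f (toReal z) ≤
      (1 - 1 / K) ^ i * (f (toReal x₀) - f (toReal z)) := by
  induction i with
  | zero => simp [hx.1]
  | succ i ih =>
    have h1 := (hx.2 i hi).gap_le hf (hx.mem_feasible hx₀ (by omega)) hz hK hK0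
    have hK' : (1 : ℝ) ≤ K := by exact_mod_cast hK0
    have h2 : (0 : ℝ) ≤ 1 - 1 / K := by
      rw [sub_nonneg, div_le_one (by linarith)]
      exact hK'
    rw [pow_succ', mul_assoc]
    exact h1.trans (mul_le_mul_of_nonneg_left (ih (by omega)) h2)

/-- `(1 - 1 / K) ^ K ≤ exp (-1) ≤ 1 / 2`, since `exp 1 ≥ 2`. -/
lemma one_sub_inv_pow_le {K : ℕ} (hK : 0 < K) (m : ℕ) :
    (1 - 1 / (K : ℝ)) ^ (K * m) ≤ (1 / 2) ^ m := by
  have hK' : (1 : ℝ) ≤ K := by exact_mod_cast hK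
  have h2 : (0 : ℝ) ≤ 1 - 1 / K := by
    rw [sub_nonneg, div_le_one (by linarith)]
    exact hK'
  rw [pow_mul]
  refine pow_le_pow_left₀ (pow_nonneg h2 _) ?_ _
  refine (Real.one_sub_div_pow_le_exp_neg hK').trans ?_
  rw [Real.exp_neg, one_div]
  exact inv_anti₀ (by norm_num) (by linarith [Real.add_one_le_exp (1 : ℝ)])

/-- The length of a greedy run is bounded by a product of encoding lengths. -/
lemma IsGreedyRun.length_le (hf : SeparableConvex f) {M δ : ℚ}
    (hM : ∀ x ∈ feasible A b l u, |f (toReal x)| < (M : ℝ)) (hδ : 0 < δ)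
    (hsep : ∀ x ∈ feasible A b l u, ∀ y ∈ feasible A b l u,
      f (toReal x) ≠ f (toReal y) → (δ : ℝ) ≤ |f (toReal x) - f (toReal y)|)
    {x₀ : Fin n → ℤ} (hx₀ : x₀ ∈ feasible A b l u) {k : ℕ} {x : ℕ → Fin n → ℤ}
    (hx : IsGreedyRun A b l u f x₀ k x) {K : ℕ} (hK : encVec l + encVec u ≤ K) (hK0 : 0 < K) :
    k ≤ K * (1 + encRat M + encRat δ) := by
  rcases k with _ | k
  · exact Nat.zero_le _
  by_contra! hlt
  set m := 1 + encRat M + encRat δ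
  obtain ⟨z, hz, hzmin⟩ :=
    Set.exists_min_image _ (fun w => f (toReal w)) (feasible_finite A b l u) ⟨x₀, hx₀⟩
  have hopt : IsOptimal A b l u f z := ⟨hz, hzmin⟩
  have hi : K * m ≤ k := by omega
  have hgap := hx.gap_le hf hx₀ hopt hK hK0 (i := K * m) (by omega)
  have hfeas := hx.mem_feasible hx₀ (i := K * m) (by omega)
  -- The run is assumed longer than `K * m`, so an improving step leaves `x (K * m)`; its gap is
  -- therefore nonzero and at least `δ`.
  have hstep := hx.2 (K * m) (by omega)
  have hpos : f (toReal z) < f (toReal (x (K * m))) :=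
    (hzmin _ hstep.2.1).trans_lt hstep.2.2.2
  have hd := hsep _ hfeas _ hz hpos.ne'
  rw [abs_of_pos (by linarith)] at hd
  have h0 : f (toReal x₀) - f (toReal z) < 2 * M := by
    have h1 := (abs_lt.1 (hM _ hx₀)).2
    have h2 := (abs_lt.1 (hM _ hz)).1
    linarith
  have h0' : 0 ≤ f (toReal x₀) - f (toReal z) := sub_nonneg.2 (hzmin _ hx₀)
  have h1 : (δ : ℝ) ≤ (1 / 2) ^ m * (f (toReal x₀) - f (toReal z)) :=
    hd.trans (hgap.trans (mul_le_mul_of_nonneg_right (one_sub_inv_pow_le hK0 m) h0'))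
  have h2 : (δ : ℝ) < (1 / 2) ^ m * (2 * M) :=
    h1.trans_lt (mul_lt_mul_of_pos_left h0 (by positivity))
  have h3 : (δ : ℝ) * 2 ^ m < 2 * M := by
    rwa [one_div, inv_pow, inv_mul_eq_div, lt_div_iff₀ (by positivity)] at h2
  have h4 := le_two_pow_encRat M
  have h5 := inv_two_pow_encRat_le hδ
  -- The three summands of `m` serve the factor `2`, the bound `M ≤ 2 ^ encRat M` and the bound `1 ≤
  -- δ * 2 ^ encRat δ`; together they contradict `h3`.
  have h6 : (δ : ℝ) * 2 ^ m = 2 * 2 ^ encRat M * (δ * 2 ^ encRat δ) := by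
    simp only [m, pow_add, pow_one]
    ring
  have h7 : (0 : ℝ) < 2 * 2 ^ encRat M := by positivity
  nlinarith

/-- With run lengths bounded, a longest run exists; if its end were not optimal, another greedy step
would extend it. -/
lemma exists_optimal_run (hf : SeparableConvex f) {x₀ : Fin n → ℤ}
    (hx₀ : x₀ ∈ feasible A b l u) {N : ℕ}
    (hN : ∀ (k : ℕ) (x : ℕ → Fin n → ℤ), IsGreedyRun A b l u f x₀ k x → k ≤ N) :
    ∃ (k : ℕ) (x : ℕ → Fin n → ℤ),
      IsGreedyRun A b l u f x₀ k x ∧ IsOptimal A b l u f (x k) := by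
  classical
  let P : ℕ → Prop := fun k => ∃ x, IsGreedyRun A b l u f x₀ k x
  have hP0 : P 0 := ⟨fun _ => x₀, rfl, fun i hi => absurd hi (Nat.not_lt_zero i)⟩
  obtain ⟨x, hx⟩ : P (Nat.findGreatest P N) := Nat.findGreatest_spec (Nat.zero_le N) hP0
  set k := Nat.findGreatest P N
  refine ⟨k, x, hx, ?_⟩
  by_contra hopt
  obtain ⟨y, hy⟩ := exists_greedyStep hf (hx.mem_feasible hx₀ le_rfl) hopt
  have hrun : IsGreedyRun A b l u f x₀ (k + 1) (Function.update x (k + 1) y) := by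
    refine ⟨by rw [Function.update_of_ne (by omega)]; exact hx.1, fun i hi => ?_⟩
    rw [Function.update_of_ne (show i ≠ k + 1 by omega)]
    rcases Nat.lt_succ_iff_lt_or_eq.1 hi with h | rfl
    · rw [Function.update_of_ne (by omega)]
      exact hx.2 i h
    · rwa [Function.update_self]
  have := Nat.le_findGreatest (hN _ _ hrun) (show P (k + 1) from ⟨_, hrun⟩)
  omega

end GraverAug

theorem mainTheorem5 :
    ∃ p : Polynomial ℕ,
      ∀ (d n : ℕ) (A : Matrix (Fin d) (Fin n) ℤ) (b : Fin d → ℤ) (l u : Fin n → ℤ)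
        (f : (Fin n → ℝ) → ℝ) (M δ : ℚ),
        GraverAug.SeparableConvex f →
        (∀ x ∈ GraverAug.feasible A b l u, |f (GraverAug.toReal x)| < (M : ℝ)) →
        0 < δ →
        (∀ x ∈ GraverAug.feasible A b l u, ∀ y ∈ GraverAug.feasible A b l u,
          f (GraverAug.toReal x) ≠ f (GraverAug.toReal y) →
            (δ : ℝ) ≤ |f (GraverAug.toReal x) - f (GraverAug.toReal y)|) →
        ∀ x₀ ∈ GraverAug.feasible A b l u, ∀ N : ℕ,
          N = p.eval (GraverAug.encMat A + GraverAug.encVec b + GraverAug.encVec l +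
            GraverAug.encVec u + GraverAug.encRat M + GraverAug.encRat δ +
            GraverAug.encVec x₀) →
          (∃ k ≤ N, ∃ x : ℕ → Fin n → ℤ,
            GraverAug.IsGreedyRun A b l u f x₀ k x ∧ GraverAug.IsOptimal A b l u f (x k)) ∧
          (∀ (k : ℕ) (x : ℕ → Fin n → ℤ), GraverAug.IsGreedyRun A b l u f x₀ k x →
            k ≤ N ∧ (GraverAug.IsOptimal A b l u f (x k) ∨
              ∃ y, GraverAug.IsGreedyStep A b l u f (x k) y)) := by
  -- With `L` the total encoding length, `K = L + 1` is positive and bounds the number of terms, and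
  -- `1 + encRat M + encRat δ ≤ L + 1` bounds the other factor.
  refine ⟨(Polynomial.X + 1) ^ 2, ?_⟩
  intro d n A b l u f M δ hf hM hδ hsep x₀ hx₀ N hN
  have hbound : ∀ (k : ℕ) (x : ℕ → Fin n → ℤ),
      GraverAug.IsGreedyRun A b l u f x₀ k x → k ≤ N := by
    intro k x hx
    set L := GraverAug.encMat A + GraverAug.encVec b + GraverAug.encVec l +
      GraverAug.encVec u + GraverAug.encRat M + GraverAug.encRat δ + GraverAug.encVec x₀
      with hL
    have h := hx.length_le hf hM hδ hsep hx₀ (K := L + 1) (by omega) (by omega)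
    rw [hN]
    simp only [Polynomial.eval_pow, Polynomial.eval_add, Polynomial.eval_X,
      Polynomial.eval_one]
    rw [sq]
    exact h.trans (Nat.mul_le_mul_left _ (by omega))
  refine ⟨?_, fun k x hx => ⟨hbound k x hx, ?_⟩⟩
  · obtain ⟨k, x, hx, hopt⟩ := GraverAug.exists_optimal_run hf hx₀ hbound
    exact ⟨k, hbound k x hx, x, hx, hopt⟩
  · by_cases hopt : GraverAug.IsOptimal A b l u f (x k)
    · exact Or.inl hopt
    · exact Or.inr (GraverAug.exists_greedyStep hf (hx.mem_feasible hx₀ le_rfl) hopt)
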